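/- **Theorem (Hyers–Ulam stability).** Let $n$ be a positive integer, let $\gamma$ and $\alpha_0,\alpha_1,\dots,\alpha_n$ be real numbers with $\alpha_0=1$, and let $z_1,\dots,z_n\in\mathbb{C}$ satisfy $$\alpha_m=\sum_{1\le i_1<\cdots<i_m\le n} z_{i_1}z_{i_2}\cdots z_{i_m}\qquad (m=1,\dots,n).$$ For functions $y:(0,\infty)\to\mathbb{C}$ let $(t^\gamma D)^0y=y$, $(t^\gamma D)y=t^\gamma y'$ and $(t^\gamma D)^{k}y=(t^\gamma D)^{k-1}(t^\gamma Dy)$, and consider the differential equation $$\sum_{k=0}^n \alpha_{n-k}(t^\gamma D)^k y(t)=0,\qquad t\in(0,\infty).\tag{$*$}$$ Call $y$ *admissible* if $(t^\gamma D)^k y$ is differentiable on $(0,\infty)$ for each $k=0,\dots,n-1$; solutions of $(*)$ are understood to be admissible. Equation $(*)$ is *Hyers–Ulam stable on $(0,\infty)$* if there is a constant $K>0$ such that for every $\varepsilon>0$ and every admissible $x:(0,\infty)\to\mathbb{C}$ with $$\Bigl|\sum_{k=0}^n \alpha_{n-k}(t^\gamma D)^k x(t)\Bigr|\le\varepsilon\quad\text{for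 all } t\in(0,\infty),$$ there is a solution $y:(0,\infty)\to\mathbb{C}$ of $(*)$ with $|y(t)-x(t)|\le K\varepsilon$ for all $t\in(0,\infty)$. Then $(*)$ is Hyers–Ulam stable on $(0,\infty)$ if and only if $\operatorname{Re} z_k\ne 0$ for every $k=1,\dots,n$. -/

import Mathlib

/-- The first-order operator `φ D`, sending `y` to `φ · y'`; its `k`-th power `(φ D)^k` is the
iterate `(weightedDeriv φ)^[k]`. -/
noncomputable def weightedDeriv (φ : ℝ → ℝ) (y : ℝ → ℂ) : ℝ → ℂ :=
  fun t => (φ t : ℂ) * deriv y t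

/-- `y` may be inserted into an operator of order `n` in `φ D` on the open set `J`: each of
`y, (φ D) y, …, (φ D)^(n-1) y` is differentiable at every point of `J`. (A function on `J` is
represented by any extension of it to `ℝ`; only its values on `J` matter.) -/
def IterDifferentiableOn (φ : ℝ → ℝ) (n : ℕ) (J : Set ℝ) (y : ℝ → ℂ) : Prop :=
  ∀ k < n, ∀ t ∈ J, DifferentiableAt ℝ ((weightedDeriv φ)^[k] y) t

/-- The operator `∑_{k=0}^n α_{n-k} (φ D)^k`. -/
noncomputable def nestedOp (φ : ℝ → ℝ) (n : ℕ) (α : ℕ → ℝ) (y : ℝ → ℂ) (t : ℝ) : ℂ :=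
  ∑ k ∈ Finset.range (n + 1), (α (n - k) : ℂ) * ((weightedDeriv φ)^[k] y) t

/-- `y` is a solution on `J` of `∑_{k=0}^n α_{n-k} (φ D)^k y = 0`. -/
def IsNestedSolution (φ : ℝ → ℝ) (n : ℕ) (α : ℕ → ℝ) (J : Set ℝ) (y : ℝ → ℂ) : Prop :=
  IterDifferentiableOn φ n J y ∧ ∀ t ∈ J, nestedOp φ n α y t = 0

/-- Hyers-Ulam stability on `J` of `∑_{k=0}^n α_{n-k} (φ D)^k y = 0`: there is a constant `K > 0`
such that every `ε`-approximate solution lies within `K ε` of an exact solution. -/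
def HyersUlamStable (φ : ℝ → ℝ) (n : ℕ) (α : ℕ → ℝ) (J : Set ℝ) : Prop :=
  ∃ K : ℝ, 0 < K ∧ ∀ ε : ℝ, 0 < ε → ∀ x : ℝ → ℂ, IterDifferentiableOn φ n J x →
    (∀ t ∈ J, ‖nestedOp φ n α x t‖ ≤ ε) →
      ∃ y : ℝ → ℂ, IsNestedSolution φ n α J y ∧ ∀ t ∈ J, ‖y t - x t‖ ≤ K * ε

/-- The elementary symmetric function `∑_{i₁ < ⋯ < iₘ} z_{i₁} ⋯ z_{iₘ}`. -/
def elemSymm {n : ℕ} (z : Fin n → ℂ) (m : ℕ) : ℂ :=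
  ∑ s ∈ Finset.powersetCard m (Finset.univ : Finset (Fin n)), ∏ i ∈ s, z i

/-! Let `E` be a primitive of `1/φ`. In the variable `E` the operator `φ D` is plain
differentiation, and by Vieta the equation reads `∏ (φ D + z_i) y = 0`. All that is used of `φ =
t^γ` is that it is positive and continuous and that `|E|` is unbounded. If every `Re z_i ≠ 0`, the
factors are treated one at a time. A first-order factor is stable with constant `1/|Re z|`
(`IsWeight.firstOrder_stable`), so the constants multiply. If `Re z_k = 0`, force the equation with
`e^{-z_k E}`, of modulus one. Stability would give a bounded `d` with `∏ (φ D + z_i) d = e^{-z_k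
E}`. Resonance forbids this (`IsWeight.not_bounded_of_resonance`): with `q` the product of the other
`j = n - 1` factors, `e^{z_k E} q(φ D) d` is `E` plus a constant, so its `j`-fold primitives have
order `|E|^{j+1}`, whereas boundedness of `d` provides one that is `O((1 + |E|)^j)`. -/

open Polynomial Set

/-- `H` is differentiable on `J` with `φ H' = F` there (for `φ` nonvanishing on `J`). -/
def IsWeightedPrimitive (φ : ℝ → ℝ) (J : Set ℝ) (F H : ℝ → ℂ) : Prop :=
  ∀ t ∈ J, HasDerivAt H ((φ t : ℂ)⁻¹ * F t) t

/-- The operator `p(φ D)` for a complex polynomial `p`. -/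
noncomputable def polyOp (φ : ℝ → ℝ) (p : ℂ[X]) (y : ℝ → ℂ) (t : ℝ) : ℂ :=
  p.sum fun k a => a * ((weightedDeriv φ)^[k] y) t

/-- `G` is a `j`-fold iterated weighted primitive of `F`. -/
def IsIterPrimitive (φ : ℝ → ℝ) (J : Set ℝ) : ℕ → (ℝ → ℂ) → (ℝ → ℂ) → Prop
  | 0, F, G => EqOn F G J
  | j + 1, F, G => ∃ H, IsWeightedPrimitive φ J F H ∧ IsIterPrimitive φ J j H G

/-- `F` grows at most like the `k`-th power of `E` on `J`. -/
def HasGrowth (E : ℝ → ℝ) (J : Set ℝ) (k : ℕ) (F : ℝ → ℂ) : Prop :=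
  ∃ C : ℝ, 0 ≤ C ∧ ∀ t ∈ J, ‖F t‖ ≤ C * (1 + |E t|) ^ k

/-- `φ` is a positive continuous weight on the open interval `J`, and `E` is a primitive
of `1 / φ`. -/
structure IsWeight (φ E : ℝ → ℝ) (J : Set ℝ) : Prop where
  isOpen : IsOpen J
  ordConnected : J.OrdConnected
  nonempty : J.Nonempty
  pos : ∀ t ∈ J, 0 < φ t
  continuousOn : ContinuousOn φ J
  hasDerivAt : ∀ t ∈ J, HasDerivAt E (φ t)⁻¹ t

variable {φ E : ℝ → ℝ} {J : Set ℝ}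

/-! ### Weighted primitives and integrating factors -/

section Primitive

variable {F F₁ F₂ H H₁ H₂ : ℝ → ℂ}

theorem IsWeightedPrimitive.congr (h : IsWeightedPrimitive φ J F₁ H) (hF : EqOn F₁ F₂ J) :
    IsWeightedPrimitive φ J F₂ H := fun t ht => hF ht ▸ h t ht

theorem IsWeightedPrimitive.continuousOn (h : IsWeightedPrimitive φ J F H) :
    ContinuousOn H J := fun t ht => (h t ht).continuousAt.continuousWithinAt

theorem IsWeightedPrimitive.add (h₁ : IsWeightedPrimitive φ J F₁ H₁)
    (h₂ : IsWeightedPrimitive φ J F₂ H₂) :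
    IsWeightedPrimitive φ J (F₁ + F₂) (H₁ + H₂) := fun t ht => by
  simpa only [Pi.add_apply, mul_add] using (h₁ t ht).add (h₂ t ht)

theorem IsWeightedPrimitive.const_smul (c : ℂ) (h : IsWeightedPrimitive φ J F H) :
    IsWeightedPrimitive φ J (c • F) (c • H) := fun t ht => by
  refine ((h t ht).const_mul c).congr_deriv ?_
  rw [Pi.smul_apply, smul_eq_mul]
  ring

theorem IsWeightedPrimitive.sub (h₁ : IsWeightedPrimitive φ J F₁ H₁)
    (h₂ : IsWeightedPrimitive φ J F₂ H₂) :
    IsWeightedPrimitive φ J (F₁ - F₂) (H₁ - H₂) := fun t ht => by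
  simpa only [Pi.sub_apply, mul_sub] using (h₁ t ht).sub (h₂ t ht)

theorem IsWeight.hasDerivAt_exp (hw : IsWeight φ E J) (z : ℂ) {t : ℝ} (ht : t ∈ J) :
    HasDerivAt (fun t => Complex.exp (z * E t))
      ((φ t : ℂ)⁻¹ * (z * Complex.exp (z * E t))) t := by
  convert (((hw.hasDerivAt t ht).ofReal_comp).const_mul z).cexp using 1
  push_cast
  ring

theorem IsWeight.continuousOn_exp (hw : IsWeight φ E J) (z : ℂ) :
    ContinuousOn (fun t => Complex.exp (z * E t)) J :=
  fun _ ht => (hw.hasDerivAt_exp z ht).continuousAt.continuousWithinAt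

/-- Integrating factor: conjugation by `e^{zE}` turns `φ D + z` into `φ D`. -/
theorem IsWeight.exp_mul (hw : IsWeight φ E J) (z : ℂ) (h : IsWeightedPrimitive φ J F H) :
    IsWeightedPrimitive φ J (fun t => Complex.exp (z * E t) * (F t + z * H t))
      (fun t => Complex.exp (z * E t) * H t) := fun t ht => by
  refine ((hw.hasDerivAt_exp z ht).mul (h t ht)).congr_deriv ?_
  ring

theorem IsWeight.exists_primitive (hw : IsWeight φ E J) (hF : ContinuousOn F J) :
    ∃ H, IsWeightedPrimitive φ J F H := by
  obtain ⟨t₀, ht₀⟩ := hw.nonempty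
  have hc : ContinuousOn (fun t => (φ t : ℂ)⁻¹ * F t) J := by
    refine ContinuousOn.mul (ContinuousOn.inv₀ ?_ ?_) hF
    · exact Complex.continuous_ofReal.comp_continuousOn hw.continuousOn
    · intro t ht
      exact_mod_cast (hw.pos t ht).ne'
  refine ⟨fun t => ∫ s in t₀..t, (φ s : ℂ)⁻¹ * F s, fun t ht => ?_⟩
  refine intervalIntegral.integral_hasDerivAt_right ?_
    (hc.stronglyMeasurableAtFilter hw.isOpen t ht) (hc.continuousAt (hw.isOpen.mem_nhds ht))
  exact (hc.mono (hw.ordConnected.uIcc_subset ht₀ ht)).intervalIntegrable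

theorem IsWeight.exists_firstOrder_solution (hw : IsWeight φ E J) (z : ℂ)
    (hF : ContinuousOn F J) :
    ∃ v, IsWeightedPrimitive φ J (fun t => F t - z * v t) v := by
  obtain ⟨H, hH⟩ := hw.exists_primitive ((hw.continuousOn_exp z).mul hF)
  refine ⟨_, (hw.exp_mul (-z) hH).congr fun t _ => ?_⟩
  have : Complex.exp (-z * E t) * Complex.exp (z * E t) = 1 := by
    rw [← Complex.exp_add]; simp
  simp only [Pi.mul_apply]
  linear_combination F t * this

end Primitive

/-! ### Stability of a first-order factor -/

section MeanValue

theorem norm_sub_le_sub_of_norm_deriv_le (hJ : J.OrdConnected) {u u' : ℝ → ℂ} {g g' : ℝ → ℝ}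
    (hu : ∀ t ∈ J, HasDerivAt u (u' t) t) (hg : ∀ t ∈ J, HasDerivAt g (g' t) t)
    (h : ∀ t ∈ J, ‖u' t‖ ≤ g' t) {a b : ℝ} (ha : a ∈ J) (hb : b ∈ J) (hab : a ≤ b) :
    ‖u b - u a‖ ≤ g b - g a := by
  have hs : Icc a b ⊆ J := hJ.out ha hb
  refine image_norm_le_of_norm_deriv_right_le_deriv_boundary'
    (f := fun t => u t - u a) (f' := u') (B := fun t => g t - g a) (B' := g')
    ?_ ?_ (by simp) ?_ ?_ (fun t ht => h t (hs (Ico_subset_Icc_self ht))) (right_mem_Icc.2 hab)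
  · exact fun t ht => ((hu t (hs ht)).sub_const _).continuousAt.continuousWithinAt
  · exact fun t ht => ((hu t (hs (Ico_subset_Icc_self ht))).sub_const _).hasDerivWithinAt
  · exact fun t ht => ((hg t (hs ht)).sub_const _).continuousAt.continuousWithinAt
  · exact fun t ht => ((hg t (hs (Ico_subset_Icc_self ht))).sub_const _).hasDerivWithinAt

/-- The closed balls of centre `u t` and radius `g t` are nested, so by compactness they share a
point `c`. This replaces a limit of `u` at the end where `g` tends to zero, so it need not be known
which end that is. -/
theorem exists_forall_norm_sub_le {u : ℝ → ℂ} {g : ℝ → ℝ} (hg : ∀ t ∈ J, 0 ≤ g t)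
    (h : ∀ s ∈ J, ∀ t ∈ J, ‖u s - u t‖ ≤ |g s - g t|) :
    ∃ c, ∀ t ∈ J, ‖u t - c‖ ≤ g t := by
  rcases J.eq_empty_or_nonempty with rfl | hne
  · simp
  have : Nonempty J := hne.to_subtype
  have key : ∀ s t : J, g s ≤ g t →
      Metric.closedBall (u s) (g s) ⊆ Metric.closedBall (u t) (g t) := by
    intro s t hst
    refine Metric.closedBall_subset_closedBall' ?_
    have := h s s.2 t t.2
    rw [abs_of_nonpos (by linarith)] at this
    rw [dist_eq_norm]
    linarith
  have hdir : Directed (· ⊇ ·) fun t : J => Metric.closedBall (u t) (g t) := by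
    intro s t
    rcases le_total (g s) (g t) with hst | hst
    · exact ⟨s, subset_rfl, key s t hst⟩
    · exact ⟨t, key t s hst, subset_rfl⟩
  obtain ⟨c, hc⟩ := IsCompact.nonempty_iInter_of_directed_nonempty_isCompact_isClosed _ hdir
    (fun t => Metric.nonempty_closedBall.2 (hg t t.2))
    (fun t => isCompact_closedBall _ _) (fun t => Metric.isClosed_closedBall)
  refine ⟨c, fun t ht => ?_⟩
  rw [← dist_eq_norm, dist_comm]
  exact Set.mem_iInter.1 hc ⟨t, ht⟩

/-- Multiplied by `e^{zE}`, the error against an exact solution `p` varies no faster than `(ε / Re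
z) e^{Re z E}`. It therefore stays within `(ε / |Re z|) e^{Re z E}` of some constant `c`, and
correcting `p` by `c e^{-zE}` cancels the exponential. -/
theorem IsWeight.firstOrder_stable (hw : IsWeight φ E J) {z : ℂ} (hz : z.re ≠ 0) {ε : ℝ}
    (hε : 0 ≤ ε) {F v h : ℝ → ℂ} (hv : IsWeightedPrimitive φ J F v) (hh : ContinuousOn h J)
    (hb : ∀ t ∈ J, ‖F t + z * v t - h t‖ ≤ ε) :
    ∃ v₀, IsWeightedPrimitive φ J (fun t => h t - z * v₀ t) v₀ ∧
      ∀ t ∈ J, ‖v₀ t - v t‖ ≤ ε / |z.re| := by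
  obtain ⟨p, hp⟩ := hw.exists_firstOrder_solution z hh
  have hu := hw.exp_mul z (hv.sub hp)
  set u : ℝ → ℂ := fun t => Complex.exp (z * E t) * (v - p) t with hu_def
  have hnorm : ∀ t, ‖Complex.exp (z * E t)‖ = Real.exp (z.re * E t) := fun t => by
    simp [Complex.norm_exp]
  have hgd : ∀ c : ℝ, ∀ t ∈ J, HasDerivAt (fun t => c * Real.exp (z.re * E t))
      (c * (Real.exp (z.re * E t) * (z.re * (φ t)⁻¹))) t := fun c t ht =>
    (((hw.hasDerivAt t ht).const_mul z.re).exp).const_mul c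
  -- The signed quotient `ε / z.re` makes the comparison function increasing for either sign of
  -- `z.re`.
  have hu' : ∀ t ∈ J, ‖(φ t : ℂ)⁻¹ * (Complex.exp (z * E t) *
      ((F - fun t => h t - z * p t) t + z * (v - p) t))‖ ≤
      ε / z.re * (Real.exp (z.re * E t) * (z.re * (φ t)⁻¹)) := fun t ht => by
    have h1 : (F - fun t => h t - z * p t) t + z * (v - p) t = F t + z * v t - h t := by
      simp only [Pi.sub_apply]; ring
    rw [h1, norm_mul, norm_mul, hnorm, norm_inv, Complex.norm_real, Real.norm_eq_abs,
      abs_of_pos (hw.pos t ht)]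
    calc (φ t)⁻¹ * (Real.exp (z.re * E t) * ‖F t + z * v t - h t‖)
        ≤ (φ t)⁻¹ * (Real.exp (z.re * E t) * ε) := by
          have := hw.pos t ht
          gcongr
          exact hb t ht
      _ = _ := by field_simp
  have hle : ∀ s ∈ J, ∀ t ∈ J, s ≤ t → ‖u t - u s‖ ≤
      |ε / |z.re| * Real.exp (z.re * E s) - ε / |z.re| * Real.exp (z.re * E t)| := by
    intro s hs t ht hst
    have := norm_sub_le_sub_of_norm_deriv_le hw.ordConnected hu (hgd _) hu' hs ht hst
    refine this.trans ((le_abs_self _).trans_eq ?_)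
    rw [← mul_sub, ← mul_sub, abs_mul, abs_mul, abs_div, abs_div, abs_abs, abs_sub_comm]
  obtain ⟨c, hc⟩ := exists_forall_norm_sub_le (J := J) (u := u)
    (g := fun t => ε / |z.re| * Real.exp (z.re * E t)) (fun t _ => by positivity)
    (fun s hs t ht => by
      rcases le_total s t with hst | hst
      · rw [norm_sub_rev]; exact hle s hs t ht hst
      · rw [abs_sub_comm]; exact hle t ht s hs hst)
  refine ⟨fun t => p t + c * Complex.exp (-z * E t), fun t ht => ?_, fun t ht => ?_⟩
  · refine ((hp t ht).add ((hw.hasDerivAt_exp (-z) ht).const_mul c)).congr_deriv ?_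
    ring
  · have hone : Complex.exp (-z * E t) * Complex.exp (z * E t) = 1 := by
      rw [← Complex.exp_add]; simp
    have h1 : p t + c * Complex.exp (-z * E t) - v t = -(Complex.exp (-z * E t) * (u t - c)) := by
      simp only [hu_def, Pi.sub_apply]
      linear_combination (v t - p t) * hone
    rw [h1, norm_neg, norm_mul]
    have h2 : ‖Complex.exp (-z * E t)‖ * Real.exp (z.re * E t) = 1 := by
      rw [← hnorm, ← norm_mul, hone, norm_one]
    calc ‖Complex.exp (-z * E t)‖ * ‖u t - c‖
        ≤ ‖Complex.exp (-z * E t)‖ * (ε / |z.re| * Real.exp (z.re * E t)) := by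
          gcongr
          exact hc t ht
      _ = ε / |z.re| := by linear_combination (ε / |z.re|) * h2

end MeanValue

/-! ### Polynomials in `φ D` and their factorization -/

section PolyOp

variable {y : ℝ → ℂ} {n : ℕ} {p q : ℂ[X]}

theorem polyOp_eq_sum_range (hp : p.natDegree < n) (t : ℝ) :
    polyOp φ p y t = ∑ k ∈ Finset.range n, p.coeff k * ((weightedDeriv φ)^[k] y) t :=
  p.sum_over_range' (fun _ => by simp) n hp

theorem polyOp_add (t : ℝ) : polyOp φ (p + q) y t = polyOp φ p y t + polyOp φ q y t :=
  sum_add_index _ _ _ (fun _ => by simp) (fun _ _ _ => by ring)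

theorem polyOp_C_mul (c : ℂ) (t : ℝ) : polyOp φ (C c * p) y t = c * polyOp φ p y t := by
  rw [polyOp, C_mul', sum_smul_index _ _ _ (fun _ => by simp), polyOp, Polynomial.sum,
    Polynomial.sum, Finset.mul_sum]
  exact Finset.sum_congr rfl fun _ _ => by ring

theorem polyOp_C (c : ℂ) (t : ℝ) : polyOp φ (C c) y t = c * y t := by
  simp [polyOp, sum_C_index]

theorem polyOp_one (t : ℝ) : polyOp φ 1 y t = y t := by
  simpa using polyOp_C (φ := φ) (y := y) 1 t

theorem polyOp_X_add_C_mul (z : ℂ) (t : ℝ) :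
    polyOp φ ((X + C z) * p) y t = polyOp φ (X * p) y t + z * polyOp φ p y t := by
  rw [add_mul, polyOp_add, polyOp_C_mul]

theorem IsWeight.hasDerivAt_iterate (hw : IsWeight φ E J) (hy : IterDifferentiableOn φ n J y)
    {k : ℕ} (hk : k < n) {t : ℝ} (ht : t ∈ J) :
    HasDerivAt ((weightedDeriv φ)^[k] y) ((φ t : ℂ)⁻¹ * ((weightedDeriv φ)^[k + 1] y) t) t := by
  have : (φ t : ℂ) ≠ 0 := by exact_mod_cast (hw.pos t ht).ne'
  rw [Function.iterate_succ_apply', weightedDeriv, inv_mul_cancel_left₀ this]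
  exact (hy k hk t ht).hasDerivAt

theorem IsWeight.polyOp_primitive (hw : IsWeight φ E J) (hy : IterDifferentiableOn φ n J y)
    (hp : p.natDegree < n) :
    IsWeightedPrimitive φ J (polyOp φ (X * p) y) (polyOp φ p y) := fun t ht => by
  have h1 : polyOp φ p y =
      fun t => ∑ k ∈ Finset.range n, p.coeff k * ((weightedDeriv φ)^[k] y) t :=
    funext (polyOp_eq_sum_range hp)
  have hd : (X * p).natDegree < n + 1 := by
    have := natDegree_mul_le (p := (X : ℂ[X])) (q := p)
    rw [natDegree_X] at this
    omega
  rw [h1, polyOp_eq_sum_range hd, Finset.sum_range_succ']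
  simp only [coeff_X_mul, coeff_X_mul_zero, zero_mul, add_zero, Finset.mul_sum]
  refine HasDerivAt.fun_sum fun k hk => ?_
  refine ((hw.hasDerivAt_iterate hy (Finset.mem_range.1 hk) ht).const_mul _).congr_deriv ?_
  ring

/-- Since `p` is monic, `(φ D)^n y` is `v` minus lower-order terms, all differentiable; this gains
the one order of regularity needed to apply a further factor. -/
theorem IsWeight.polyOp_lift (hw : IsWeight φ E J) (hy : IterDifferentiableOn φ n J y)
    (hp : p.Monic) (hn : p.natDegree = n) {F v : ℝ → ℂ} (hv : IsWeightedPrimitive φ J F v)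
    (h : EqOn (polyOp φ p y) v J) :
    IterDifferentiableOn φ (n + 1) J y ∧ EqOn (polyOp φ (X * p) y) F J := by
  have hy' : IterDifferentiableOn φ (n + 1) J y := by
    intro k hk t ht
    rcases (Nat.lt_succ_iff.1 hk).lt_or_eq with hk | rfl
    · exact hy k hk t ht
    · have hd : DifferentiableAt ℝ (fun t => v t -
          ∑ j ∈ Finset.range k, p.coeff j * ((weightedDeriv φ)^[j] y) t) t :=
        (hv t ht).differentiableAt.sub (DifferentiableAt.fun_sum fun j hj =>
          (hy j (Finset.mem_range.1 hj) t ht).const_mul _)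
      refine hd.congr_of_eventuallyEq ?_
      filter_upwards [hw.isOpen.mem_nhds ht] with s hs
      have hc : p.coeff k = 1 := by rw [← hn]; exact hp
      rw [← h hs, polyOp_eq_sum_range (n := k + 1) (by omega), Finset.sum_range_succ, hc]
      ring
  refine ⟨hy', fun t ht => ?_⟩
  have h1 := hw.polyOp_primitive hy' (p := p) (by omega) t ht
  have h2 : HasDerivAt (polyOp φ p y) ((φ t : ℂ)⁻¹ * F t) t :=
    (hv t ht).congr_of_eventuallyEq (h.eventuallyEq_of_mem (hw.isOpen.mem_nhds ht))
  have : (φ t : ℂ)⁻¹ ≠ 0 := inv_ne_zero (by exact_mod_cast (hw.pos t ht).ne')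
  exact mul_left_cancel₀ this (h1.unique h2)

theorem monic_prod_X_add_C (z : Fin n → ℂ) : (∏ i, (X + C (z i))).Monic :=
  monic_prod_of_monic _ _ fun _ _ => monic_X_add_C _

theorem natDegree_prod_X_add_C (z : Fin n → ℂ) : (∏ i, (X + C (z i))).natDegree = n := by
  rw [natDegree_prod_of_monic _ _ fun _ _ => monic_X_add_C _]
  simp

theorem IsWeight.exists_polyOp_eq (hw : IsWeight φ E J) (z : Fin n → ℂ) {h : ℝ → ℂ}
    (hh : ContinuousOn h J) :
    ∃ y, IterDifferentiableOn φ n J y ∧ EqOn (polyOp φ (∏ i, (X + C (z i))) y) h J := by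
  induction n generalizing h with
  | zero => exact ⟨h, fun k hk => absurd hk (by omega), fun t _ => by simp [polyOp_one]⟩
  | succ n ih =>
    obtain ⟨v, hv⟩ := hw.exists_firstOrder_solution (z 0) hh
    obtain ⟨y, hy, hyv⟩ := ih (fun i => z i.succ) hv.continuousOn
    obtain ⟨hy', he⟩ := hw.polyOp_lift hy (monic_prod_X_add_C _) (natDegree_prod_X_add_C _) hv hyv
    refine ⟨y, hy', fun t ht => ?_⟩
    rw [Fin.prod_univ_succ, polyOp_X_add_C_mul, he ht, hyv ht]
    ring

/-- The right-hand side `h` is general because the induction changes it: the first factor is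
corrected to yield an exact `v₀`, which becomes the right-hand side for the remaining factors. -/
theorem IsWeight.polyOp_stable (hw : IsWeight φ E J) (z : Fin n → ℂ) (hz : ∀ i, (z i).re ≠ 0)
    {ε : ℝ} (hε : 0 ≤ ε) {h x : ℝ → ℂ} (hh : ContinuousOn h J)
    (hx : IterDifferentiableOn φ n J x)
    (hb : ∀ t ∈ J, ‖polyOp φ (∏ i, (X + C (z i))) x t - h t‖ ≤ ε) :
    ∃ y, IterDifferentiableOn φ n J y ∧ EqOn (polyOp φ (∏ i, (X + C (z i))) y) h J ∧
      ∀ t ∈ J, ‖y t - x t‖ ≤ (∏ i, |(z i).re|)⁻¹ * ε := by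
  induction n generalizing h ε with
  | zero =>
    refine ⟨h, fun k hk => absurd hk (by omega), fun t _ => by simp [polyOp_one], fun t ht => ?_⟩
    simpa [polyOp_one, norm_sub_rev] using hb t ht
  | succ n ih =>
    have hv := hw.polyOp_primitive hx (p := ∏ i : Fin n, (X + C (z i.succ)))
      (by rw [natDegree_prod_X_add_C]; omega)
    obtain ⟨v, hv', hvb⟩ := hw.firstOrder_stable (hz 0) hε hv hh fun t ht => by
      simpa only [Fin.prod_univ_succ, polyOp_X_add_C_mul] using hb t ht
    obtain ⟨y, hy, hyv, hyb⟩ := ih (fun i => z i.succ) (fun i => hz _)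
      (div_nonneg hε (abs_nonneg (z 0).re)) hv'.continuousOn (fun k hk => hx k (by omega)) fun t ht => by
        rw [norm_sub_rev]; exact hvb t ht
    obtain ⟨hy', he⟩ := hw.polyOp_lift hy (monic_prod_X_add_C _) (natDegree_prod_X_add_C _)
      hv' hyv
    refine ⟨y, hy', fun t ht => ?_, fun t ht => (hyb t ht).trans_eq ?_⟩
    · rw [Fin.prod_univ_succ, polyOp_X_add_C_mul, he ht, hyv ht]
      ring
    · rw [Fin.prod_univ_succ, mul_inv]
      ring

theorem nestedOp_eq_polyOp {α : ℕ → ℝ} (hα : α 0 = 1) {z : Fin n → ℂ}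
    (hz : ∀ m : ℕ, 1 ≤ m → m ≤ n → (α m : ℂ) = elemSymm z m) (t : ℝ) :
    nestedOp φ n α y t = polyOp φ (∏ i, (X + C (z i))) y t := by
  rw [polyOp_eq_sum_range (n := n + 1) (by rw [natDegree_prod_X_add_C]; omega), nestedOp]
  refine Finset.sum_congr rfl fun k hk => ?_
  congr 1
  have hk' : k ≤ n := Nat.lt_succ_iff.1 (Finset.mem_range.1 hk)
  rw [Finset.prod_X_add_C_coeff _ _ (by simpa using hk')]
  simp only [Finset.card_univ, Fintype.card_fin]
  rcases Nat.eq_zero_or_pos (n - k) with h | h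
  · simp [h, hα]
  · exact hz _ h (Nat.sub_le _ _)

theorem IsWeight.polyOp_sub {x : ℝ → ℂ} (hw : IsWeight φ E J) (hx : IterDifferentiableOn φ n J x)
    (hy : IterDifferentiableOn φ n J y) (hp : p.natDegree ≤ n) :
    IterDifferentiableOn φ n J (x - y) ∧
      EqOn (polyOp φ p (x - y)) (polyOp φ p x - polyOp φ p y) J := by
  have key : ∀ k ≤ n, EqOn ((weightedDeriv φ)^[k] (x - y))
      ((weightedDeriv φ)^[k] x - (weightedDeriv φ)^[k] y) J := by
    intro k
    induction k with
    | zero => exact fun _ _ _ => rfl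
    | succ k ih =>
      intro hk t ht
      have := (ih (by omega)).eventuallyEq_of_mem (hw.isOpen.mem_nhds ht)
      simp only [Function.iterate_succ_apply', weightedDeriv, Pi.sub_apply]
      rw [this.deriv_eq, deriv_sub (hx k hk t ht) (hy k hk t ht), mul_sub]
  refine ⟨fun k hk t ht => ?_, fun t ht => ?_⟩
  · exact ((hx k hk t ht).sub (hy k hk t ht)).congr_of_eventuallyEq
      ((key k hk.le).eventuallyEq_of_mem (hw.isOpen.mem_nhds ht))
  · simp only [Pi.sub_apply, polyOp_eq_sum_range (Nat.lt_succ_of_le hp), ← Finset.sum_sub_distrib]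
    refine Finset.sum_congr rfl fun k hk => ?_
    rw [key k (Nat.lt_succ_iff.1 (Finset.mem_range.1 hk)) ht, Pi.sub_apply, mul_sub]

end PolyOp

/-! ### Polynomial growth in `E` and resonance -/

section Growth

variable {F F₁ F₂ G G₁ G₂ : ℝ → ℂ} {j k : ℕ}

theorem HasGrowth.add (h₁ : HasGrowth E J k F₁) (h₂ : HasGrowth E J k F₂) :
    HasGrowth E J k (F₁ + F₂) := by
  obtain ⟨C₁, hC₁, h₁⟩ := h₁
  obtain ⟨C₂, hC₂, h₂⟩ := h₂
  refine ⟨C₁ + C₂, by positivity, fun t ht => (norm_add_le _ _).trans ?_⟩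
  rw [add_mul]
  exact add_le_add (h₁ t ht) (h₂ t ht)

theorem HasGrowth.const_smul (c : ℂ) (h : HasGrowth E J k F) : HasGrowth E J k (c • F) := by
  obtain ⟨C, hC, h⟩ := h
  refine ⟨‖c‖ * C, by positivity, fun t ht => ?_⟩
  rw [Pi.smul_apply, norm_smul, mul_assoc]
  gcongr
  exact h t ht

theorem HasGrowth.mono (h : HasGrowth E J j F) (hjk : j ≤ k) : HasGrowth E J k F := by
  obtain ⟨C, hC, h⟩ := h
  refine ⟨C, hC, fun t ht => (h t ht).trans ?_⟩
  have : 1 ≤ 1 + |E t| := by simp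
  gcongr

theorem HasGrowth.congr (h : HasGrowth E J k F) (hFG : EqOn F G J) : HasGrowth E J k G := by
  obtain ⟨C, hC, h⟩ := h
  exact ⟨C, hC, fun t ht => hFG ht ▸ h t ht⟩

/-- Mean value inequality against `E` from a base point `t₀`: `E` is monotone, so between `t₀` and
`t` its modulus is at most `|E t₀| + |E t|`. -/
theorem IsWeight.hasGrowth_primitive (hw : IsWeight φ E J) (hF : HasGrowth E J k F)
    (h : IsWeightedPrimitive φ J F G) : HasGrowth E J (k + 1) G := by
  obtain ⟨C, hC, hF⟩ := hF
  obtain ⟨t₀, ht₀⟩ := hw.nonempty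
  have hEmono : ∀ a ∈ J, ∀ b ∈ J, a ≤ b → E a ≤ E b := fun a ha b hb hab => by
    have := norm_sub_le_sub_of_norm_deriv_le hw.ordConnected (u := 0) (u' := 0)
      (fun t _ => hasDerivAt_const t 0) hw.hasDerivAt
      (fun t ht => by simpa using (hw.pos t ht).le) ha hb hab
    simp only [Pi.zero_apply, sub_zero, norm_zero] at this
    linarith
  have key : ∀ M : ℝ, ∀ a ∈ J, ∀ b ∈ J, a ≤ b → (∀ t ∈ Icc a b, ‖F t‖ ≤ M) →
      ‖G b - G a‖ ≤ M * |E b - E a| := by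
    intro M a ha b hb hab hM
    have hs : Icc a b ⊆ J := hw.ordConnected.out ha hb
    have := norm_sub_le_sub_of_norm_deriv_le (J := Icc a b) ordConnected_Icc
      (fun t ht => h t (hs ht)) (fun t ht => (hw.hasDerivAt t (hs ht)).const_mul M)
      (fun t ht => by
        have hp := hw.pos t (hs ht)
        rw [norm_mul, norm_inv, Complex.norm_real, Real.norm_eq_abs, abs_of_pos hp, mul_comm]
        gcongr
        exact hM t ht) (left_mem_Icc.2 hab) (right_mem_Icc.2 hab) hab
    rw [abs_of_nonneg (sub_nonneg.2 (hEmono a ha b hb hab)), mul_sub]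
    exact this
  have hbound : ∀ t ∈ J,
      ‖G t - G t₀‖ ≤ C * (1 + |E t₀| + |E t|) ^ k * (|E t| + |E t₀|) := by
    intro t ht
    refine le_trans ?_ (mul_le_mul_of_nonneg_left (abs_sub (E t) (E t₀)) (by positivity))
    have hM : ∀ s ∈ J, (E t₀ ≤ E s ∧ E s ≤ E t) ∨ (E t ≤ E s ∧ E s ≤ E t₀) →
        ‖F s‖ ≤ C * (1 + |E t₀| + |E t|) ^ k := by
      intro s hs hE
      refine (hF s hs).trans ?_
      have : |E s| ≤ |E t₀| + |E t| := by
        rw [abs_le]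
        have := abs_le.1 (le_refl |E t|)
        have := abs_le.1 (le_refl |E t₀|)
        constructor <;> rcases hE with hE | hE <;> linarith [abs_nonneg (E t), abs_nonneg (E t₀)]
      rw [add_assoc]
      gcongr
    rcases le_total t₀ t with htt | htt
    · refine key _ t₀ ht₀ t ht htt fun s hs => ?_
      have hsJ := hw.ordConnected.out ht₀ ht hs
      exact hM s hsJ (.inl ⟨hEmono _ ht₀ _ hsJ hs.1, hEmono _ hsJ _ ht hs.2⟩)
    · rw [norm_sub_rev, abs_sub_comm]
      refine key _ t ht t₀ ht₀ htt fun s hs => ?_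
      have hsJ := hw.ordConnected.out ht ht₀ hs
      exact hM s hsJ (.inr ⟨hEmono _ ht _ hsJ hs.1, hEmono _ hsJ _ ht₀ hs.2⟩)
  refine ⟨C * (1 + |E t₀|) ^ (k + 1) + ‖G t₀‖, by positivity, fun t ht => ?_⟩
  have h1 : (1 + |E t₀| + |E t|) ≤ (1 + |E t₀|) * (1 + |E t|) := by
    nlinarith [mul_nonneg (abs_nonneg (E t)) (abs_nonneg (E t₀))]
  have h2 : |E t| + |E t₀| ≤ (1 + |E t₀|) * (1 + |E t|) := by linarith
  have h3 : 1 ≤ (1 + |E t|) ^ (k + 1) := one_le_pow₀ (by simp)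
  calc ‖G t‖ = ‖(G t - G t₀) + G t₀‖ := by rw [sub_add_cancel]
    _ ≤ ‖G t - G t₀‖ + ‖G t₀‖ := norm_add_le _ _
    _ ≤ C * ((1 + |E t₀|) * (1 + |E t|)) ^ k * ((1 + |E t₀|) * (1 + |E t|))
        + ‖G t₀‖ * (1 + |E t|) ^ (k + 1) := by
      refine add_le_add ((hbound t ht).trans ?_) (le_mul_of_one_le_right (norm_nonneg _) h3)
      gcongr
    _ = _ := by
      rw [mul_pow]
      ring

theorem IsIterPrimitive.congr_left (h : IsIterPrimitive φ J j F₁ G) (hF : EqOn F₁ F₂ J) :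
    IsIterPrimitive φ J j F₂ G := by
  cases j with
  | zero => exact hF.symm.trans h
  | succ j =>
    obtain ⟨H, hH, hG⟩ := h
    exact ⟨H, hH.congr hF, hG⟩

theorem IsIterPrimitive.add (h₁ : IsIterPrimitive φ J j F₁ G₁)
    (h₂ : IsIterPrimitive φ J j F₂ G₂) : IsIterPrimitive φ J j (F₁ + F₂) (G₁ + G₂) := by
  induction j generalizing F₁ F₂ with
  | zero => exact fun t ht => congr_arg₂ (· + ·) (h₁ ht) (h₂ ht)
  | succ j ih =>
    obtain ⟨H₁, hH₁, hG₁⟩ := h₁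
    obtain ⟨H₂, hH₂, hG₂⟩ := h₂
    exact ⟨_, hH₁.add hH₂, ih hG₁ hG₂⟩

theorem IsIterPrimitive.const_smul (c : ℂ) (h : IsIterPrimitive φ J j F G) :
    IsIterPrimitive φ J j (c • F) (c • G) := by
  induction j generalizing F with
  | zero => exact fun t ht => congr_arg (c • ·) (h ht)
  | succ j ih =>
    obtain ⟨H, hH, hG⟩ := h
    exact ⟨_, hH.const_smul c, ih hG⟩

theorem IsWeight.exists_iterPrimitive (hw : IsWeight φ E J) (hF : ContinuousOn F J) (j : ℕ) :
    ∃ G, IsIterPrimitive φ J j F G := by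
  induction j generalizing F with
  | zero => exact ⟨F, fun _ _ => rfl⟩
  | succ j ih =>
    obtain ⟨H, hH⟩ := hw.exists_primitive hF
    obtain ⟨G, hG⟩ := ih hH.continuousOn
    exact ⟨G, H, hH, hG⟩

theorem IsWeight.hasGrowth_iterPrimitive (hw : IsWeight φ E J) (hF : HasGrowth E J k F)
    (h : IsIterPrimitive φ J j F G) : HasGrowth E J (k + j) G := by
  induction j generalizing F k with
  | zero => exact hF.congr h
  | succ j ih =>
    obtain ⟨H, hH, hG⟩ := h
    exact (ih (hw.hasGrowth_primitive hF hH) hG).mono (by omega)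

theorem IsWeight.iterPrimitive_pow (hw : IsWeight φ E J) (j k : ℕ) :
    IsIterPrimitive φ J j (fun t => ((E t : ℂ) ^ k / (k.factorial : ℂ)))
      (fun t => ((E t : ℂ) ^ (k + j) / ((k + j).factorial : ℂ))) := by
  induction j generalizing k with
  | zero => exact fun _ _ => rfl
  | succ j ih =>
    refine ⟨fun t => ((E t : ℂ) ^ (k + 1) / ((k + 1).factorial : ℂ)), fun t ht => ?_, ?_⟩
    · refine ((((hw.hasDerivAt t ht).ofReal_comp).pow (k + 1)).div_const
        ((k + 1).factorial : ℂ)).congr_deriv ?_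
      have h1 : ((k : ℂ) + 1) ≠ 0 := by exact_mod_cast k.succ_ne_zero
      have h2 : (k.factorial : ℂ) ≠ 0 := by exact_mod_cast k.factorial_ne_zero
      rw [Nat.factorial_succ]
      push_cast
      field_simp
    · have := ih (k + 1)
      rwa [show k + 1 + j = k + (j + 1) by omega] at this

/-- If `e^{zE} d` is bounded and `p` has degree at most `j`, then `e^{zE} p(φ D) d` is the `j`-th
weighted derivative of a function of growth `O((1 + |E|)^j)`. -/
theorem IsWeight.exists_iterPrimitive_polyOp (hw : IsWeight φ E J) (z : ℂ) {d : ℝ → ℂ}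
    (hd : IterDifferentiableOn φ j J d) (hc : ContinuousOn d J)
    (hg : HasGrowth E J 0 fun t => Complex.exp (z * E t) * d t) {p : ℂ[X]}
    (hp : p.natDegree ≤ j) :
    ∃ G, IsIterPrimitive φ J j (fun t => Complex.exp (z * E t) * polyOp φ p d t) G ∧
      HasGrowth E J j G := by
  induction j generalizing p with
  | zero =>
    refine ⟨_, fun _ _ => rfl, (hg.const_smul (p.coeff 0)).congr fun t _ => ?_⟩
    rw [eq_C_of_natDegree_le_zero hp, polyOp_C, coeff_C_zero, Pi.smul_apply, smul_eq_mul]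
    ring
  | succ j ih =>
    -- Divide by `X + z`. The quotient part is a weighted derivative of `e^{zE} r(φ D) d`, covered
    -- by induction; the remainder is a multiple of the bounded `e^{zE} d`, integrated `j + 1`
    -- times.
    set r : ℂ[X] := p /ₘ (X - C (-z)) with hr
    have hrd : r.natDegree ≤ j := by
      rw [hr, natDegree_divByMonic _ (monic_X_sub_C _), natDegree_X_sub_C]
      omega
    have hpr : p = (X + C z) * r + C (p.eval (-z)) := by
      conv_lhs => rw [← modByMonic_add_div p (X - C (-z)), modByMonic_X_sub_C_eq_C_eval]
      rw [add_comm, hr, C_neg, sub_neg_eq_add]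
    obtain ⟨G₁, hG₁, hG₁'⟩ := ih (fun k hk => hd k (by omega)) hrd
    obtain ⟨G₂, hG₂⟩ := hw.exists_iterPrimitive ((hw.continuousOn_exp z).mul hc) (j + 1)
    have hG₂' := hw.hasGrowth_iterPrimitive hg hG₂
    rw [zero_add] at hG₂'
    have h1 : IsIterPrimitive φ J (j + 1) _ G₁ :=
      ⟨_, hw.exp_mul z (hw.polyOp_primitive hd (p := r) (by omega)), hG₁⟩
    refine ⟨_, (h1.add (hG₂.const_smul (p.eval (-z)))).congr_left fun t _ => ?_,
      (hG₁'.mono j.le_succ).add (hG₂'.const_smul _)⟩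
    conv_rhs => rw [hpr, polyOp_add, polyOp_X_add_C_mul, polyOp_C]
    simp only [Pi.add_apply, Pi.smul_apply, Pi.mul_apply, smul_eq_mul]
    ring

theorem IsWeight.not_bounded_of_resonance (hw : IsWeight φ E J)
    (hE : ∀ M : ℝ, ∃ t ∈ J, M < |E t|) {z : ℂ} (hz : z.re = 0) {d : ℝ → ℂ}
    (hd : IterDifferentiableOn φ (j + 1) J d) {p : ℂ[X]} (hp : p.natDegree ≤ j)
    (h : ∀ t ∈ J, polyOp φ ((X + C z) * p) d t = Complex.exp (-z * E t)) (K : ℝ) :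
    ¬ ∀ t ∈ J, ‖d t‖ ≤ K := by
  intro hK
  have hnorm : ∀ t, ‖Complex.exp (z * E t)‖ = 1 := fun t => by
    simp [Complex.norm_exp, hz]
  have hg : HasGrowth E J 0 fun t => Complex.exp (z * E t) * d t := by
    obtain ⟨t₀, ht₀⟩ := hw.nonempty
    refine ⟨K, (norm_nonneg _).trans (hK t₀ ht₀), fun t ht => ?_⟩
    simpa [hnorm] using hK t ht
  have hc : ContinuousOn d J := fun t ht =>
    (hd 0 (by omega) t ht).continuousAt.continuousWithinAt
  obtain ⟨G, hG, hG'⟩ := hw.exists_iterPrimitive_polyOp z (fun k hk => hd k (by omega)) hc hg hp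
  have h1 := hw.exp_mul z (hw.polyOp_primitive hd (p := p) (by omega))
  -- The first primitive `H` in this chain differs from `e^{zE} p(φ D) d` by a constant, both having
  -- weighted derivative `1`.
  have hpow := hw.iterPrimitive_pow (j + 1) 0
  obtain ⟨H, hH, hHG⟩ := hpow
  have hzero := h1.add (hH.const_smul (-1))
  have hconst : HasGrowth E J 0 ((fun t => Complex.exp (z * E t) * polyOp φ p d t)
      + (-1 : ℂ) • H) := by
    obtain ⟨t₀, ht₀⟩ := hw.nonempty
    set f := (fun t => Complex.exp (z * E t) * polyOp φ p d t) + (-1 : ℂ) • H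
    refine ⟨‖f t₀‖, norm_nonneg _, fun t ht => ?_⟩
    have hd0 : ∀ s ∈ J, HasDerivAt f 0 s := fun s hs => by
      convert hzero s hs using 1
      have hone : Complex.exp (z * E s) * Complex.exp (-z * E s) = 1 := by
        rw [← Complex.exp_add]; simp
      have := h s hs
      rw [polyOp_X_add_C_mul] at this
      simp [this]
      right
      rw [← sub_eq_add_neg, sub_eq_zero, ← hone, neg_mul]
    have : ∀ a ∈ J, ∀ b ∈ J, a ≤ b → f b = f a := fun a ha b hb hab => by
      have := norm_sub_le_sub_of_norm_deriv_le hw.ordConnected hd0 (g := 0) (g' := 0)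
        (fun t _ => hasDerivAt_const t 0) (fun _ _ => by simp) ha hb hab
      simpa [sub_eq_zero] using this
    have heq : f t = f t₀ := by
      rcases le_total t t₀ with htt | htt
      · exact (this _ ht _ ht₀ htt).symm
      · exact this _ ht₀ _ ht htt
    simp [heq]
  have hdiff := hw.hasGrowth_iterPrimitive hconst (hG.add (hHG.const_smul (-1)))
  rw [zero_add] at hdiff
  obtain ⟨C, hC, hbound⟩ := hG'.add (hdiff.const_smul (-1))
  set N : ℝ := ((j + 1).factorial : ℝ) with hN
  have hNpos : 0 < N := by positivity
  -- The summand `1` ensures `1 + |E t| ≤ 2 |E t|`; the rest exceeds the bound on `|E t|` that the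
  -- growth estimate then forces.
  obtain ⟨t, ht, hlt⟩ := hE (1 + C * 2 ^ j * N)
  have hb := hbound t ht
  have heq : (G + (-1 : ℂ) • (G + (-1 : ℂ) • fun t =>
      ((E t : ℂ) ^ (0 + (j + 1)) / ((0 + (j + 1)).factorial : ℂ)))) t =
      (E t : ℂ) ^ (j + 1) / ((j + 1).factorial : ℂ) := by
    simp
  rw [heq, norm_div, norm_pow, Complex.norm_real, Complex.norm_natCast, Real.norm_eq_abs, ← hN,
    div_le_iff₀ hNpos] at hb
  have hx1 : 1 ≤ |E t| := le_trans (le_add_of_nonneg_right (by positivity)) hlt.le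
  have h2 : (1 + |E t|) ^ j ≤ 2 ^ j * |E t| ^ j := by
    rw [← mul_pow]
    gcongr
    linarith
  have h3 : |E t| ^ (j + 1) ≤ (C * 2 ^ j * N) * |E t| ^ j := by
    refine hb.trans ?_
    calc C * (1 + |E t|) ^ j * N ≤ C * (2 ^ j * |E t| ^ j) * N := by gcongr
      _ = _ := by ring
  rw [pow_succ', mul_le_mul_iff_left₀ (by positivity)] at h3
  linarith

end Growth

/-! ### The criterion for general weights and for `t^γ` -/

theorem IsWeight.hyersUlamStable_iff (hw : IsWeight φ E J) (hE : ∀ M : ℝ, ∃ t ∈ J, M < |E t|)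
    {n : ℕ} {α : ℕ → ℝ} (hα : α 0 = 1) {z : Fin n → ℂ}
    (hz : ∀ m : ℕ, 1 ≤ m → m ≤ n → (α m : ℂ) = elemSymm z m) :
    HyersUlamStable φ n α J ↔ ∀ k : Fin n, (z k).re ≠ 0 := by
  constructor
  · rintro ⟨K, -, hK⟩ k hk
    obtain ⟨x, hx, hxe⟩ := hw.exists_polyOp_eq z (hw.continuousOn_exp (-z k))
    obtain ⟨y, ⟨hy, hy0⟩, hyx⟩ := hK 1 one_pos x hx fun t ht => by
      rw [nestedOp_eq_polyOp hα hz, hxe ht]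
      simp [Complex.norm_exp, hk]
    obtain ⟨m, rfl⟩ : ∃ m, n = m + 1 := ⟨n - 1, by have := k.pos; omega⟩
    obtain ⟨hd, hde⟩ := hw.polyOp_sub hx hy (natDegree_prod_X_add_C z).le
    have hfac := (Finset.mul_prod_erase Finset.univ (fun i => X + C (z i)) (Finset.mem_univ k))
    refine hw.not_bounded_of_resonance hE hk hd
      (p := ∏ i ∈ Finset.univ.erase k, (X + C (z i))) ?_ (fun t ht => ?_) (K * 1) fun t ht => ?_
    · rw [natDegree_prod_of_monic _ _ fun _ _ => monic_X_add_C _]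
      simp
    · rw [hfac, hde ht, Pi.sub_apply, hxe ht, ← nestedOp_eq_polyOp hα hz, hy0 t ht, sub_zero]
    · rw [Pi.sub_apply, norm_sub_rev]
      exact hyx t ht
  · intro hre
    refine ⟨(∏ i, |(z i).re|)⁻¹, inv_pos.2 (Finset.prod_pos fun i _ => abs_pos.2 (hre i)),
      fun ε hε x hx hb => ?_⟩
    obtain ⟨y, hy, hye, hyx⟩ := hw.polyOp_stable z hre hε.le (h := 0) continuousOn_const hx
      fun t ht => by simpa [nestedOp_eq_polyOp hα hz] using hb t ht
    exact ⟨y, ⟨hy, fun t ht => by rw [nestedOp_eq_polyOp hα hz, hye ht]; rfl⟩, hyx⟩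

theorem exists_isWeight_rpow (γ : ℝ) :
    ∃ E : ℝ → ℝ, IsWeight (fun t : ℝ => t ^ γ) E (Ioi 0) ∧
      ∀ M : ℝ, ∃ t ∈ Ioi (0 : ℝ), M < |E t| := by
  have key : ∀ E : ℝ → ℝ, (∀ t ∈ Ioi (0 : ℝ), HasDerivAt E (t ^ γ)⁻¹ t) →
      IsWeight (fun t : ℝ => t ^ γ) E (Ioi 0) := fun E hE =>
    { isOpen := isOpen_Ioi
      ordConnected := ordConnected_Ioi
      nonempty := ⟨1, mem_Ioi.2 one_pos⟩
      pos := fun t ht => Real.rpow_pos_of_pos ht γ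
      continuousOn := fun t ht =>
        (Real.continuousAt_rpow_const t γ (.inl (ne_of_gt ht))).continuousWithinAt
      hasDerivAt := hE }
  rcases eq_or_ne γ 1 with rfl | hγ
  · refine ⟨Real.log, key _ fun t ht => ?_, fun M => ⟨Real.exp (|M| + 1), Real.exp_pos _, ?_⟩⟩
    · simpa using Real.hasDerivAt_log (ne_of_gt ht)
    · rw [Real.log_exp]
      linarith [le_abs_self M, le_abs_self (|M| + 1)]
  · have h1 : 1 - γ ≠ 0 := sub_ne_zero.2 hγ.symm
    refine ⟨fun t => t ^ (1 - γ) / (1 - γ), key _ fun t ht => ?_, fun M => ?_⟩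
    · refine ((Real.hasDerivAt_rpow_const (p := 1 - γ) (.inl (ne_of_gt ht))).div_const
        (1 - γ)).congr_deriv ?_
      rw [← Real.rpow_neg (le_of_lt ht), show 1 - γ - 1 = -γ by ring]
      field_simp
    · have hpos : 0 < (|M| + 1) * |1 - γ| := by positivity
      -- Chosen so that `|E t| = |M| + 1`, whatever the sign of `1 - γ`.
      refine ⟨((|M| + 1) * |1 - γ|) ^ (1 - γ)⁻¹, Real.rpow_pos_of_pos hpos _, ?_⟩
      simp only
      rw [Real.rpow_inv_rpow hpos.le h1, abs_div, abs_of_pos hpos,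
        mul_div_cancel_right₀ _ (abs_ne_zero.2 h1)]
      linarith [le_abs_self M]

theorem theorem3p1 (n : ℕ) (hn : 1 ≤ n) (γ : ℝ) (α : ℕ → ℝ) (hα : α 0 = 1)
    (z : Fin n → ℂ) (hz : ∀ m : ℕ, 1 ≤ m → m ≤ n → (α m : ℂ) = elemSymm z m) :
    HyersUlamStable (fun t : ℝ => t ^ γ) n α (Set.Ioi 0) ↔ ∀ k : Fin n, (z k).re ≠ 0 := by
  obtain ⟨E, hw, hE⟩ := exists_isWeight_rpow γ
  exact hw.hyersUlamStable_iff hE hα hz
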